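/- Let $n,m\ge 2$. Write $\mathfrak B_n(U)=\{1\}\cup\{U_{ij},U_{ij}^*\}_{i,j=1}^n$ for a unitary matrix $U=(U_{ij})\in M_n(\mathcal B(\mathcal H))$, where $\mathcal H$ is a Hilbert space. Let $UC_{qs}(n,m)\subseteq\mathbb C^{(2n^2+1)(2m^2+1)}$ be the set of all families $(\langle (X\otimes Y)\psi,\psi\rangle)_{X\in\mathfrak B_n(U),\,Y\in\mathfrak B_m(V)}$, where $U\in M_n(\mathcal B(\mathcal H_A))$ and $V\in M_m(\mathcal B(\mathcal H_B))$ are unitary, $\mathcal H_A,\mathcal H_B$ are (arbitrary) Hilbert spaces, and $\psi\in\mathcal H_A\otimes\mathcal H_B$ is a unit vector. Let $B_{qs}(n,m)\subseteq\mathbb C^{n^2m^2}$ be the set of all families $(\langle (U_{ij}\otimes V_{k\ell})\psi,\psi\rangle)_{(i,j),(k,\ell)}$ with $U,V,\psi$ as before. Let $\mathcal U_{nc}(n)$ be the universal unital $C^*$-algebra generated by elements $u_{ij}$ ($1\le i,j\le n$) such that the matrix $(u_{ij})$ is unitary, and let $\mathcal V_n=\operatorname{span}\{1,u_{ij},u_{ij}^*\}_{i,j}\subseteq\mathcal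 U_{nc}(n)$ be the operator system spanned by the generators; denote the generators of $\mathcal U_{nc}(m)$ by $v_{k\ell}$. Let $\mathcal V_n\otimes_{\min}\mathcal V_m$ be the minimal tensor product of operator systems: an element $x$ of $\mathcal V_n\otimes\mathcal V_m$ is positive if and only if $(\varphi\otimes\psi)(x)\ge 0$ in $M_{pq}$ for all $p,q$ and all unital completely positive maps $\varphi:\mathcal V_n\to M_p$ and $\psi:\mathcal V_m\to M_q$. A state is a unital positive linear functional. Let $UC_{qa}(n,m)$ be the set of all families $(s(x\otimes y))$ indexed by $x\in\{1,u_{ij},u_{ij}^*\}$ and $y\in\{1,v_{k\ell},v_{k\ell}^*\}$, and $B_{qa}(n,m)$ the set of all families $(s(u_{ij}\otimes v_{k\ell}))_{(i,j),(k,\ell)}$, where $s$ ranges over the states on $\mathcal V_n\otimes_{\min}\mathcal V_m$. Then for all $n,m\ge 2$: $B_{qs}(n,m)\ne B_{qa}(n,m)$ and $UC_{qs}(n,m)\ne UC_{qa}(n,m)$; moreover, neither $UC_{qs}(n,m)$ nor $B_{qs}(n,m)$ is closed. -/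

import Mathlib

open scoped TensorProduct ENNReal Kronecker ComplexOrder

universe u v

namespace UnitaryCorrelation

/-! ## The set `𝔅_n(U) = {1} ∪ {U_ij, U_ij*}` -/

/-- Labels for the elements of `𝔅_n(U) = {1} ∪ {U_ij, U_ij*}`. -/
inductive Letter (n : ℕ) : Type
  | one : Letter n
  | gen (i j : Fin n) : Letter n
  | adj (i j : Fin n) : Letter n

/-- The element of `𝔅_n(U)` with a given label. -/
def Letter.eval {n : ℕ} {A : Type*} [One A] [Star A] (U : Matrix (Fin n) (Fin n) A) :
    Letter n → A
  | .one => 1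
  | .gen i j => U i j
  | .adj i j => star (U i j)

/-! ## Hilbert space tensor products and the operators `X ⊗ Y` on them -/

section HilbertTensor

variable {H : Type*} [NormedAddCommGroup H] [InnerProductSpace ℂ H]
  {K : Type*} [NormedAddCommGroup K] [InnerProductSpace ℂ K]

theorem exists_orthonormal_repr (z : H ⊗[ℂ] K) :
    ∃ (d : ℕ) (x : Fin d → H) (e : Fin d → K), Orthonormal ℂ e ∧ z = ∑ i, x i ⊗ₜ[ℂ] e i := by
  obtain ⟨N, hN, hz⟩ := TensorProduct.exists_finite_submodule_right_of_setFinite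
    ({z} : Set (H ⊗[ℂ] K)) (Set.finite_singleton z)
  obtain ⟨y, hy⟩ := Set.singleton_subset_iff.mp hz
  let b := stdOrthonormalBasis ℂ N
  have key : ∀ y : H ⊗[ℂ] N, ∃ x : Fin (Module.finrank ℂ N) → H, y = ∑ i, x i ⊗ₜ[ℂ] b i := by
    intro y
    induction y with
    | zero => exact ⟨0, by simp⟩
    | tmul h k =>
      refine ⟨fun i => b.repr k i • h, ?_⟩
      conv_lhs => rw [← b.sum_repr k]
      rw [TensorProduct.tmul_sum]
      simp [TensorProduct.smul_tmul]
    | add y₁ y₂ h₁ h₂ =>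
      obtain ⟨x₁, h₁⟩ := h₁
      obtain ⟨x₂, h₂⟩ := h₂
      refine ⟨x₁ + x₂, ?_⟩
      simp [h₁, h₂, TensorProduct.add_tmul, Finset.sum_add_distrib]
  obtain ⟨x, hx⟩ := key y
  refine ⟨_, x, fun i => (b i : K), ?_, ?_⟩
  · exact b.orthonormal.comp_linearIsometry N.subtypeₗᵢ
  · rw [← hy, hx]
    simp

theorem norm_sq_sum_tmul {d : ℕ} (x : Fin d → H) {e : Fin d → K} (he : Orthonormal ℂ e) :
    ‖∑ i, x i ⊗ₜ[ℂ] e i‖ ^ 2 = ∑ i, ‖x i‖ ^ 2 := by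
  have h : (inner ℂ (∑ i, x i ⊗ₜ[ℂ] e i) (∑ i, x i ⊗ₜ[ℂ] e i) : ℂ)
      = ∑ i, (‖x i‖ : ℂ) ^ 2 := by
    simp only [sum_inner, inner_sum, TensorProduct.inner_tmul]
    simp [orthonormal_iff_ite.mp he]
  have h2 := (inner_self_eq_norm_sq_to_K (𝕜 := ℂ) (∑ i, x i ⊗ₜ[ℂ] e i)).symm.trans h
  exact Complex.ofReal_injective (by push_cast; exact h2)

theorem norm_map_id_le (X : H →L[ℂ] H) (z : H ⊗[ℂ] K) :
    ‖TensorProduct.map X.toLinearMap LinearMap.id z‖ ≤ ‖X‖ * ‖z‖ := by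
  obtain ⟨d, x, e, he, rfl⟩ := exists_orthonormal_repr z
  refine le_of_sq_le_sq ?_ (by positivity)
  have : TensorProduct.map X.toLinearMap LinearMap.id (∑ i, x i ⊗ₜ[ℂ] e i)
      = ∑ i, X (x i) ⊗ₜ[ℂ] e i := by simp
  rw [this, mul_pow, norm_sq_sum_tmul _ he, norm_sq_sum_tmul _ he, Finset.mul_sum]
  refine Finset.sum_le_sum fun i _ => ?_
  rw [← mul_pow]
  gcongr
  exact X.le_opNorm _

theorem norm_id_map_le (Y : K →L[ℂ] K) (z : H ⊗[ℂ] K) :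
    ‖TensorProduct.map (LinearMap.id : H →ₗ[ℂ] H) Y.toLinearMap z‖ ≤ ‖Y‖ * ‖z‖ := by
  have h := norm_map_id_le (K := H) Y (TensorProduct.comm ℂ H K z)
  have hc : TensorProduct.map Y.toLinearMap (LinearMap.id : H →ₗ[ℂ] H)
      (TensorProduct.comm ℂ H K z)
      = TensorProduct.comm ℂ H K (TensorProduct.map LinearMap.id Y.toLinearMap z) := by
    clear h
    induction z with
    | zero => simp
    | tmul h k => simp
    | add a b ha hb => simp only [map_add, ha, hb]
  rwa [hc, TensorProduct.norm_comm, TensorProduct.norm_comm] at h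

theorem norm_map_le (X : H →L[ℂ] H) (Y : K →L[ℂ] K) (z : H ⊗[ℂ] K) :
    ‖TensorProduct.map X.toLinearMap Y.toLinearMap z‖ ≤ ‖X‖ * ‖Y‖ * ‖z‖ := by
  have h : TensorProduct.map X.toLinearMap Y.toLinearMap z
      = TensorProduct.map X.toLinearMap LinearMap.id
          (TensorProduct.map LinearMap.id Y.toLinearMap z) := by
    rw [← LinearMap.comp_apply, ← TensorProduct.map_comp]
    simp
  rw [h]
  calc _ ≤ ‖X‖ * ‖TensorProduct.map (LinearMap.id : H →ₗ[ℂ] H) Y.toLinearMap z‖ :=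
        norm_map_id_le _ _
    _ ≤ ‖X‖ * (‖Y‖ * ‖z‖) := by gcongr; exact norm_id_map_le _ _
    _ = _ := by ring

variable (H K) in
/-- The Hilbert space tensor product: the completion of the algebraic tensor product for the
inner product with `⟪x ⊗ y, x' ⊗ y'⟫ = ⟪x, x'⟫ ⟪y, y'⟫`. -/
abbrev HilbertTensor : Type _ := UniformSpace.Completion (H ⊗[ℂ] K)

/-- The bounded operator `X ⊗ Y` on the Hilbert space tensor product. -/
noncomputable def tensorOp (X : H →L[ℂ] H) (Y : K →L[ℂ] K) :
    HilbertTensor H K →L[ℂ] HilbertTensor H K :=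
  ((TensorProduct.map X.toLinearMap Y.toLinearMap).mkContinuous (‖X‖ * ‖Y‖)
    (norm_map_le X Y)).completion

theorem tensorOp_coe_tmul (X : H →L[ℂ] H) (Y : K →L[ℂ] K) (x : H) (y : K) :
    tensorOp X Y ((x ⊗ₜ[ℂ] y : H ⊗[ℂ] K) : HilbertTensor H K)
      = ((X x ⊗ₜ[ℂ] Y y : H ⊗[ℂ] K) : HilbertTensor H K) := by
  simp [tensorOp]

end HilbertTensor

/-! ## The spatial correlation sets -/

/-- `UC_qs(n,m)`: all `(⟨(X ⊗ Y)ψ, ψ⟩)` with `X ∈ 𝔅_n(U)`, `Y ∈ 𝔅_m(V)`, for unitaries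
`U ∈ M_n(B(H))`, `V ∈ M_m(B(K))` over Hilbert spaces `H`, `K` and a unit vector `ψ ∈ H ⊗ K`.
(Mathlib's inner product is conjugate linear in its first variable.) -/
def UCqs (n m : ℕ) : Set (Matrix (Letter n) (Letter m) ℂ) :=
  {c | ∃ (H : Type u) (_ : NormedAddCommGroup H) (_ : InnerProductSpace ℂ H)
      (_ : CompleteSpace H)
      (K : Type u) (_ : NormedAddCommGroup K) (_ : InnerProductSpace ℂ K)
      (_ : CompleteSpace K)
      (U : Matrix (Fin n) (Fin n) (H →L[ℂ] H)) (V : Matrix (Fin m) (Fin m) (K →L[ℂ] K))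
      (ψ : HilbertTensor H K),
      U ∈ unitary (Matrix (Fin n) (Fin n) (H →L[ℂ] H)) ∧
      V ∈ unitary (Matrix (Fin m) (Fin m) (K →L[ℂ] K)) ∧
      ‖ψ‖ = 1 ∧
      ∀ x y, c x y = inner ℂ ψ (tensorOp (Letter.eval U x) (Letter.eval V y) ψ)}

/-- `B_qs(n,m)`: the part of the correlations in `UC_qs(n,m)` with `X ∈ {U_ij}` and
`Y ∈ {V_kl}` only. -/
def Bqs (n m : ℕ) : Set (Matrix (Fin n × Fin n) (Fin m × Fin m) ℂ) :=
  {c | ∃ (H : Type u) (_ : NormedAddCommGroup H) (_ : InnerProductSpace ℂ H)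
      (_ : CompleteSpace H)
      (K : Type u) (_ : NormedAddCommGroup K) (_ : InnerProductSpace ℂ K)
      (_ : CompleteSpace K)
      (U : Matrix (Fin n) (Fin n) (H →L[ℂ] H)) (V : Matrix (Fin m) (Fin m) (K →L[ℂ] K))
      (ψ : HilbertTensor H K),
      U ∈ unitary (Matrix (Fin n) (Fin n) (H →L[ℂ] H)) ∧
      V ∈ unitary (Matrix (Fin m) (Fin m) (K →L[ℂ] K)) ∧
      ‖ψ‖ = 1 ∧
      ∀ i j k l, c (i, j) (k, l) = inner ℂ ψ (tensorOp (U i j) (V k l) ψ)}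

/-! ## The universal C*-algebra `𝒰_nc(n)` generated by the entries of a unitary matrix -/

/-- A unital C*-algebra (nonzero, in universe `u`) with a unitary `n × n` matrix over it. -/
structure UnitaryMatrixAlg (n : ℕ) : Type (u + 1) where
  A : Type u
  [cstar : CStarAlgebra A]
  [nontriv : Nontrivial A]
  U : Matrix (Fin n) (Fin n) A
  hU : U ∈ unitary (Matrix (Fin n) (Fin n) A)

attribute [instance] UnitaryMatrixAlg.cstar UnitaryMatrixAlg.nontriv

theorem norm_entry_le_one {n : ℕ} {A : Type*} [CStarAlgebra A] [Nontrivial A]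
    {U : Matrix (Fin n) (Fin n) A} (hU : U ∈ unitary (Matrix (Fin n) (Fin n) A))
    (i j : Fin n) : ‖U i j‖ ≤ 1 := by
  let _ : PartialOrder A := CStarAlgebra.spectralOrder A
  have _ : StarOrderedRing A := CStarAlgebra.spectralOrderedRing A
  have h1 : (star U * U) j j = 1 := by
    rw [(Unitary.mem_iff.mp hU).1, Matrix.one_apply_eq]
  rw [Matrix.mul_apply] at h1
  have h2 : star (U i j) * U i j ≤ 1 := by
    rw [← h1]
    exact Finset.single_le_sum (f := fun k => star U j k * U k j)
      (fun k _ => star_mul_self_nonneg (U k j)) (Finset.mem_univ i)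
  have h3 : ‖star (U i j) * U i j‖ ≤ ‖(1 : A)‖ :=
    CStarAlgebra.norm_le_norm_of_nonneg_of_le (star_mul_self_nonneg _) h2
  rw [CStarRing.norm_star_mul_self, CStarRing.norm_one] at h3
  nlinarith [norm_nonneg (U i j)]

/-- The C*-algebra of bounded families over all unital C*-algebras with a unitary matrix. -/
abbrev BigAlg (n : ℕ) : Type (u + 1) := lp (fun i : UnitaryMatrixAlg.{u} n => i.A) ∞

noncomputable instance (n : ℕ) : CStarAlgebra (BigAlg.{u} n) where

/-- The family of all `(i,j)` entries. -/
noncomputable def bigGen (n : ℕ) (i j : Fin n) : BigAlg.{u} n :=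
  ⟨fun a => a.U i j, memℓp_infty ⟨1, by
    rintro _ ⟨a, rfl⟩
    exact norm_entry_le_one a.hU i j⟩⟩

/-- The C*-subalgebra generated by the families `bigGen n i j`. -/
noncomputable def uncSubalg (n : ℕ) : StarSubalgebra ℂ (BigAlg.{u} n) :=
  (StarAlgebra.adjoin ℂ {x | ∃ i j, x = bigGen n i j}).topologicalClosure

instance (n : ℕ) : IsClosed (uncSubalg.{u} n : Set (BigAlg.{u} n)) :=
  StarSubalgebra.isClosed_topologicalClosure _

/-- `𝒰_nc(n)`: the universal unital C*-algebra with generators `u_ij` such that `(u_ij)` is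
unitary, realized inside the product of all pairs (C*-algebra, unitary matrix). -/
def Unc (n : ℕ) : Type (u + 1) := uncSubalg.{u} n

noncomputable instance (n : ℕ) : CStarAlgebra (Unc.{u} n) :=
  inferInstanceAs (CStarAlgebra (uncSubalg.{u} n))

/-- The matrix `(u_ij)` of generators of `𝒰_nc(n)`. -/
noncomputable def uncGen (n : ℕ) : Matrix (Fin n) (Fin n) (Unc.{u} n) := fun i j =>
  ⟨bigGen n i j, StarSubalgebra.le_topologicalClosure _
    (StarAlgebra.subset_adjoin ℂ _ ⟨i, j, rfl⟩)⟩

theorem uncGen_mem_unitary (n : ℕ) :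
    uncGen.{u} n ∈ unitary (Matrix (Fin n) (Fin n) (Unc.{u} n)) := by
  have coe_sum : ∀ (f : Fin n → Unc.{u} n) (a : UnitaryMatrixAlg.{u} n),
      ((∑ k, f k : Unc.{u} n)).1.1 a = ∑ k, (f k).1.1 a := by
    intro f a
    let ev : Unc.{u} n →+ a.A :=
      { toFun := fun x => x.1.1 a, map_zero' := rfl, map_add' := fun _ _ => rfl }
    exact map_sum ev f Finset.univ
  have coe_one : ∀ (i j : Fin n) (a : UnitaryMatrixAlg.{u} n),
      ((1 : Matrix (Fin n) (Fin n) (Unc.{u} n)) i j).1.1 a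
        = (1 : Matrix (Fin n) (Fin n) a.A) i j := by
    intro i j a
    by_cases h : i = j
    · subst h
      rw [Matrix.one_apply_eq, Matrix.one_apply_eq]
      rfl
    · rw [Matrix.one_apply_ne h, Matrix.one_apply_ne h]
      rfl
  rw [Unitary.mem_iff]
  constructor
  · ext i j
    refine Subtype.ext (Subtype.ext (funext fun a => ?_))
    rw [Matrix.mul_apply]
    refine (coe_sum _ a).trans ((?_ : _ = (star a.U * a.U) i j).trans ?_)
    · rw [Matrix.mul_apply]
      rfl
    · rw [(Unitary.mem_iff.mp a.hU).1]
      exact (coe_one i j a).symm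
  · ext i j
    refine Subtype.ext (Subtype.ext (funext fun a => ?_))
    rw [Matrix.mul_apply]
    refine (coe_sum _ a).trans ((?_ : _ = (a.U * star a.U) i j).trans ?_)
    · rw [Matrix.mul_apply]
      rfl
    · rw [(Unitary.mem_iff.mp a.hU).2]
      exact (coe_one i j a).symm

/-- Evaluation of `𝒰_nc(n)` at a C*-algebra with a unitary matrix. -/
def uncEval {n : ℕ} (a : UnitaryMatrixAlg.{u} n) : Unc.{u} n →⋆ₐ[ℂ] a.A where
  toFun x := x.1.1 a
  map_one' := rfl
  map_mul' _ _ := rfl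
  map_zero' := rfl
  map_add' _ _ := rfl
  commutes' _ := rfl
  map_star' _ := rfl

/-- The universal property of `𝒰_nc(n)`. -/
theorem unc_universal {n : ℕ} {A : Type u} [CStarAlgebra A] [Nontrivial A]
    (U : Matrix (Fin n) (Fin n) A) (hU : U ∈ unitary (Matrix (Fin n) (Fin n) A)) :
    ∃! π : Unc.{u} n →⋆ₐ[ℂ] A, ∀ i j, π (uncGen n i j) = U i j := by
  refine ⟨uncEval ⟨A, U, hU⟩, fun _ _ => rfl, fun π hπ => ?_⟩
  have hc : ∀ ρ : Unc.{u} n →⋆ₐ[ℂ] A, Continuous ρ := fun ρ =>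
    AddMonoidHomClass.continuous_of_bound ρ 1 fun x => by
      simpa only [one_mul] using NonUnitalStarAlgHom.norm_apply_le ρ x
  refine StarAlgHom.ext_topologicalClosure
    (S := StarAlgebra.adjoin ℂ {x | ∃ i j, x = bigGen.{u} n i j}) (hc π) (hc _) ?_
  refine StarAlgHom.ext_adjoin ?_
  rintro ⟨_, h⟩ ⟨i, j, rfl⟩
  exact hπ i j

/-! ## Operator systems, ucp maps and the minimal tensor product -/

/-- An operator system in a unital C*-algebra: a unital self-adjoint subspace. -/
structure OperatorSystem (A : Type*) [CStarAlgebra A] extends Submodule ℂ A where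
  one_mem' : (1 : A) ∈ carrier
  star_mem' : ∀ {x : A}, x ∈ carrier → star x ∈ carrier

/-- The unit of an operator system. -/
def OperatorSystem.unit {A : Type*} [CStarAlgebra A] (S : OperatorSystem A) : S.toSubmodule :=
  ⟨1, S.one_mem'⟩

/-- Positivity in the matrix algebra `M_k(A)`: the elements `Y* Y`. -/
def MatrixPos {A : Type*} [Ring A] [StarRing A] {k : ℕ} (X : Matrix (Fin k) (Fin k) A) : Prop :=
  ∃ Y : Matrix (Fin k) (Fin k) A, X = star Y * Y

/-- A linear map `φ : S → M_p` is ucp: it is unital, and for all `k` the entrywise map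
`M_k(S) → M_k(M_p)` maps positive elements (those of `M_k(S) ∩ M_k(A)₊`) to positive ones. -/
def IsUCP {A : Type*} [CStarAlgebra A] (S : OperatorSystem A) {p : ℕ}
    (φ : S.toSubmodule →ₗ[ℂ] Matrix (Fin p) (Fin p) ℂ) : Prop :=
  φ S.unit = 1 ∧
  ∀ (k : ℕ) (X : Matrix (Fin k) (Fin k) S.toSubmodule),
    MatrixPos (X.map fun x => (x : A)) → MatrixPos (X.map φ)

/-- The map `φ ⊗ ψ : S ⊗ T → M_p ⊗ M_q = M_{pq}`. -/
noncomputable def tensorMap {M N : Type*} [AddCommGroup M] [Module ℂ M] [AddCommGroup N]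
    [Module ℂ N] {p q : ℕ} (φ : M →ₗ[ℂ] Matrix (Fin p) (Fin p) ℂ)
    (ψ : N →ₗ[ℂ] Matrix (Fin q) (Fin q) ℂ) :
    M ⊗[ℂ] N →ₗ[ℂ] Matrix (Fin p × Fin q) (Fin p × Fin q) ℂ :=
  TensorProduct.lift ((Matrix.kroneckerBilinear (R := ℂ)).compl₁₂ φ ψ)

/-- The positive cone of `S ⊗_min T`: the elements that every `φ ⊗ ψ` with ucp maps
`φ : S → M_p` and `ψ : T → M_q` sends to a positive semidefinite matrix. (Only the first matrix
level enters in the definition of a state. Self-adjointness of `x` is part of the condition,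
as positive semidefinite matrices are Hermitian and the maps `φ ⊗ ψ` separate points.) -/
def MinPos {A : Type*} [CStarAlgebra A] {B : Type*} [CStarAlgebra B] (S : OperatorSystem A)
    (T : OperatorSystem B) (x : S.toSubmodule ⊗[ℂ] T.toSubmodule) : Prop :=
  ∀ (p q : ℕ) (φ : S.toSubmodule →ₗ[ℂ] Matrix (Fin p) (Fin p) ℂ)
    (ψ : T.toSubmodule →ₗ[ℂ] Matrix (Fin q) (Fin q) ℂ),
    IsUCP S φ → IsUCP T ψ → (tensorMap φ ψ x).PosSemidef

/-- States on `S ⊗_min T`: the unital positive linear functionals. -/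
def IsMinState {A : Type*} [CStarAlgebra A] {B : Type*} [CStarAlgebra B] (S : OperatorSystem A)
    (T : OperatorSystem B) (s : S.toSubmodule ⊗[ℂ] T.toSubmodule →ₗ[ℂ] ℂ) : Prop :=
  s (S.unit ⊗ₜ[ℂ] T.unit) = 1 ∧ ∀ x, MinPos S T x → 0 ≤ s x

/-- The operator system `𝒱_n = span {1, u_ij, u_ij*} ⊆ 𝒰_nc(n)`. -/
noncomputable def Vsys (n : ℕ) : OperatorSystem (Unc.{u} n) where
  toSubmodule := Submodule.span ℂ (Set.range (Letter.eval (uncGen.{u} n)))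
  one_mem' := Submodule.subset_span ⟨.one, rfl⟩
  star_mem' := by
    intro x hx
    change x ∈ Submodule.span ℂ _ at hx
    change star x ∈ Submodule.span ℂ _
    induction hx using Submodule.span_induction with
    | mem x h =>
      obtain ⟨a, rfl⟩ := h
      cases a with
      | one => exact Submodule.subset_span ⟨.one, (star_one _).symm⟩
      | gen i j => exact Submodule.subset_span ⟨.adj i j, rfl⟩
      | adj i j => exact Submodule.subset_span ⟨.gen i j, (star_star _).symm⟩
    | zero => rw [star_zero]; exact Submodule.zero_mem _
    | add x y _ _ hx hy => rw [star_add]; exact Submodule.add_mem _ hx hy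
    | smul c x _ hx => rw [star_smul]; exact Submodule.smul_mem _ _ hx

/-- The elements `1`, `u_ij`, `u_ij*` of `𝒱_n`. -/
noncomputable def Vsys.letter {n : ℕ} (a : Letter n) : (Vsys.{u} n).toSubmodule :=
  ⟨Letter.eval (uncGen.{u} n) a, Submodule.subset_span ⟨a, rfl⟩⟩

/-! ## The sets `UC_qa = UC_qmin` and `B_qa = B_qmin` -/

/-- `UC_qa(n,m) = UC_qmin(n,m)`: all `(s(x ⊗ y))` with `x ∈ {1, u_ij, u_ij*}`,
`y ∈ {1, v_kl, v_kl*}`, for states `s` on `𝒱_n ⊗_min 𝒱_m`. -/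
def UCqa (n m : ℕ) : Set (Matrix (Letter n) (Letter m) ℂ) :=
  {c | ∃ s : (Vsys.{u} n).toSubmodule ⊗[ℂ] (Vsys.{u} m).toSubmodule →ₗ[ℂ] ℂ,
      IsMinState (Vsys.{u} n) (Vsys.{u} m) s ∧
      ∀ x y, c x y = s (Vsys.letter x ⊗ₜ[ℂ] Vsys.letter y)}

/-- `B_qa(n,m) = B_qmin(n,m)`: all `(s(u_ij ⊗ v_kl))` for states `s` on `𝒱_n ⊗_min 𝒱_m`. -/
def Bqa (n m : ℕ) : Set (Matrix (Fin n × Fin n) (Fin m × Fin m) ℂ) :=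
  {c | ∃ s : (Vsys.{u} n).toSubmodule ⊗[ℂ] (Vsys.{u} m).toSubmodule →ₗ[ℂ] ℂ,
      IsMinState (Vsys.{u} n) (Vsys.{u} m) s ∧
      ∀ i j k l, c (i, j) (k, l) =
        s (Vsys.letter (.gen i j) ⊗ₜ[ℂ] Vsys.letter (.gen k l))}

end UnitaryCorrelation

/-! The separating correlation is perfect embezzlement of a maximally entangled qubit pair: a
correlation whose values on `U_00 ⊗ V_00` and on `U_10 ⊗ V_10` both equal `r = 1/√2`.

No spatial model attains it. The first columns of `U` and `V` are isometries, so the vectors `(U_i0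
⊗ V_j0)ψ` have squared norms summing to 1. The two prescribed values already exhaust this total,
which forces `(U_i0 ⊗ V_i0)ψ = rψ` for `i = 0, 1` and makes all other such vectors vanish. Hence the
overlaps of `ψ` with product vectors satisfy a recursion that shrinks them by the factor `r` at
every step, and `ψ = 0` (`not_perfect_embezzlement`).

It is nevertheless a limit of finite-dimensional correlations. In the van Dam–Hayden manner, take a
vector `ψ` with Schmidt coefficients `r ^ ⌊log₂ k⌋` and permutation unitaries that split off the
last binary digit of `k`; the values obtained are `r N/(N+1)` (`exists_approx_embezzlement`). These
correlations belong to both `UC_qs` and `UC_qa`. They are uniformly bounded, so they have a limit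
point, and `UC_qa` contains it because pointwise limits of states are states
(`mem_UCqa_of_tendsto`). This one limit point gives all four claims, since restriction to the
generators is continuous. -/

namespace UnitaryCorrelation

open Filter Topology

/-! ### Impossibility of exact embezzlement in a spatial tensor product -/

section NoEmbezzlement

variable {H : Type*} [NormedAddCommGroup H] [InnerProductSpace ℂ H]
  {K : Type*} [NormedAddCommGroup K] [InnerProductSpace ℂ K]

theorem norm_tensorOp_le (X : H →L[ℂ] H) (Y : K →L[ℂ] K) : ‖tensorOp X Y‖ ≤ ‖X‖ * ‖Y‖ := by
  refine ContinuousLinearMap.opNorm_le_bound _ (by positivity) fun z => ?_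
  induction z using UniformSpace.Completion.induction_on with
  | hp => exact isClosed_le (by fun_prop) (by fun_prop)
  | ih z =>
    rw [tensorOp, ContinuousLinearMap.completion_apply_coe, UniformSpace.Completion.norm_coe,
      UniformSpace.Completion.norm_coe]
    exact norm_map_le X Y z

theorem eq_zero_of_inner_tmul_eq_zero {ψ : HilbertTensor H K}
    (h : ∀ x y, (inner ℂ ((x ⊗ₜ[ℂ] y : H ⊗[ℂ] K) : HilbertTensor H K) ψ : ℂ) = 0) : ψ = 0 := by
  have : ∀ φ : HilbertTensor H K, (inner ℂ φ ψ : ℂ) = 0 := by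
    intro φ
    induction φ using UniformSpace.Completion.induction_on with
    | hp => exact isClosed_eq (by fun_prop) (by fun_prop)
    | ih a =>
      induction a with
      | zero => rw [UniformSpace.Completion.coe_zero, inner_zero_left]
      | add a b ha hb => rw [UniformSpace.Completion.coe_add, inner_add_left, ha, hb, add_zero]
      | tmul x y => exact h x y
  exact inner_self_eq_zero.mp (this ψ)

variable [CompleteSpace H] [CompleteSpace K]

theorem sum_inner_of_sum_star_mul_self {ι : Type*} [Fintype ι] {A : ι → H →L[ℂ] H}
    (hA : ∑ i, star (A i) * A i = 1) (x x' : H) :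
    ∑ i, (inner ℂ (A i x) (A i x') : ℂ) = inner ℂ x x' := by
  have h : (∑ i, star (A i) * A i) x' = x' := by rw [hA]; rfl
  conv_rhs => rw [← h]
  rw [_root_.sum_apply, inner_sum]
  refine Finset.sum_congr rfl fun i _ => ?_
  rw [mul_apply_eq_comp, ContinuousLinearMap.star_eq_adjoint,
    ContinuousLinearMap.adjoint_inner_right]

/-- The columns `x ↦ (A i x)` and `y ↦ (B j y)` are isometries, hence so is their tensor product. On
elementary tensors the inner product factors; additivity and density do the rest. -/
theorem sum_inner_tensorOp {ι κ : Type*} [Fintype ι] [Fintype κ] {A : ι → H →L[ℂ] H}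
    {B : κ → K →L[ℂ] K} (hA : ∑ i, star (A i) * A i = 1) (hB : ∑ j, star (B j) * B j = 1)
    (ξ η : HilbertTensor H K) :
    ∑ p : ι × κ, (inner ℂ (tensorOp (A p.1) (B p.2) ξ) (tensorOp (A p.1) (B p.2) η) : ℂ)
      = inner ℂ ξ η := by
  induction ξ, η using UniformSpace.Completion.induction_on₂ with
  | hp => exact isClosed_eq (by fun_prop) (by fun_prop)
  | ih a b =>
    simp only [tensorOp, ContinuousLinearMap.completion_apply_coe,
      UniformSpace.Completion.inner_coe, LinearMap.mkContinuous_apply]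
    induction a with
    | zero => simp
    | add a a' ha ha' => simp only [map_add, inner_add_left, Finset.sum_add_distrib, ha, ha']
    | tmul x y =>
      induction b with
      | zero => simp
      | add a a' ha ha' => simp only [map_add, inner_add_right, Finset.sum_add_distrib, ha, ha']
      | tmul x' y' =>
        simp only [TensorProduct.map_tmul, TensorProduct.inner_tmul,
          ContinuousLinearMap.coe_coe]
        rw [← sum_inner_of_sum_star_mul_self hA x x', ← sum_inner_of_sum_star_mul_self hB y y',
          Finset.sum_mul_sum, Fintype.sum_prod_type]

theorem norm_sq_add_norm_sq_le {ι : Type*} [Fintype ι] {A : ι → H →L[ℂ] H}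
    (hA : ∑ i, star (A i) * A i = 1) {i₀ i₁ : ι} (hi : i₀ ≠ i₁) (x : H) :
    ‖A i₀ x‖ ^ 2 + ‖A i₁ x‖ ^ 2 ≤ ‖x‖ ^ 2 := by
  classical
  have h := sum_inner_of_sum_star_mul_self hA x x
  simp only [inner_self_eq_norm_sq_to_K] at h
  have h' : ∑ i, ‖A i x‖ ^ 2 = ‖x‖ ^ 2 :=
    Complex.ofReal_injective (by push_cast; exact h)
  rw [← h', ← Finset.sum_pair (f := fun i => ‖A i x‖ ^ 2) hi]
  exact Finset.sum_le_sum_of_subset_of_nonneg (Finset.subset_univ _) fun _ _ _ => by positivity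

variable {ι κ : Type*} [Fintype ι] [Fintype κ] {A : ι → H →L[ℂ] H} {B : κ → K →L[ℂ] K}

/-- Equality case of Cauchy–Schwarz: the squared distances between the vectors `T p` and their
claimed values sum to `1 - 2 r ^ 2 = 0`, so each of them vanishes. -/
theorem tensorOp_apply_eq_of_inner_eq [DecidableEq ι] [DecidableEq κ]
    (hA : ∑ i, star (A i) * A i = 1)
    (hB : ∑ j, star (B j) * B j = 1) {i₀ i₁ : ι} (hi : i₀ ≠ i₁) {j₀ j₁ : κ}
    {ψ : HilbertTensor H K} (hψ : ‖ψ‖ = 1) {r : ℝ} (hr : 2 * r ^ 2 = 1)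
    (h₀ : (inner ℂ ψ (tensorOp (A i₀) (B j₀) ψ) : ℂ) = r)
    (h₁ : (inner ℂ ψ (tensorOp (A i₁) (B j₁) ψ) : ℂ) = r) (p : ι × κ) :
    tensorOp (A p.1) (B p.2) ψ
      = if p ∈ ({(i₀, j₀), (i₁, j₁)} : Finset (ι × κ)) then (r : ℂ) • ψ else 0 := by
  have hne : (i₀, j₀) ≠ (i₁, j₁) := fun h => hi (congrArg Prod.fst h)
  set s : Finset (ι × κ) := {(i₀, j₀), (i₁, j₁)} with hs
  set T : ι × κ → HilbertTensor H K := fun p => tensorOp (A p.1) (B p.2) ψ with hT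
  have hTsum : ∑ p, ‖T p‖ ^ 2 = 1 := by
    have h := sum_inner_tensorOp hA hB ψ ψ
    simp only [inner_self_eq_norm_sq_to_K, hψ] at h
    exact Complex.ofReal_injective (by push_cast; simpa using h)
  have hterm : ∀ p, ‖T p - if p ∈ s then (r : ℂ) • ψ else 0‖ ^ 2
      = ‖T p‖ ^ 2 - if p ∈ s then r ^ 2 else 0 := by
    intro p
    split_ifs with hp
    · have hin : (inner ℂ ψ (T p) : ℂ) = r := by
        rw [hs, Finset.mem_insert, Finset.mem_singleton] at hp
        rcases hp with rfl | rfl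
        · exact h₀
        · exact h₁
      have hin' : (inner ℂ (T p) ((r : ℂ) • ψ) : ℂ) = (r ^ 2 : ℝ) := by
        rw [inner_smul_right, ← inner_conj_symm, hin, Complex.conj_ofReal]
        push_cast; ring
      have hre : RCLike.re (inner ℂ (T p) ((r : ℂ) • ψ) : ℂ) = r ^ 2 := by
        rw [hin']; exact Complex.ofReal_re _
      rw [norm_sub_sq (𝕜 := ℂ), hre, norm_smul, hψ, Complex.norm_real, mul_one, Real.norm_eq_abs,
        sq_abs]
      ring
    · simp
  have hzero : ∑ p, ‖T p - if p ∈ s then (r : ℂ) • ψ else 0‖ ^ 2 = 0 := by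
    simp only [hterm, Finset.sum_sub_distrib, hTsum, Finset.sum_ite_mem, Finset.univ_inter]
    rw [hs, Finset.sum_pair hne]
    linarith
  have := (Finset.sum_eq_zero_iff_of_nonneg fun _ _ => by positivity).mp hzero p
    (Finset.mem_univ _)
  exact sub_eq_zero.mp (norm_eq_zero.mp (pow_eq_zero_iff two_ne_zero |>.mp this))

/-- Perfect embezzlement of a maximally entangled pair of qubits is impossible in the spatial
tensor product: the largest Schmidt coefficient would have to shrink. -/
theorem not_perfect_embezzlement (hA : ∑ i, star (A i) * A i = 1)
    (hB : ∑ j, star (B j) * B j = 1) {i₀ i₁ : ι} (hi : i₀ ≠ i₁) {j₀ j₁ : κ} (hj : j₀ ≠ j₁)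
    {ψ : HilbertTensor H K} (hψ : ‖ψ‖ = 1) {r : ℝ} (hr₀ : 0 ≤ r) (hr : 2 * r ^ 2 = 1)
    (h₀ : (inner ℂ ψ (tensorOp (A i₀) (B j₀) ψ) : ℂ) = r)
    (h₁ : (inner ℂ ψ (tensorOp (A i₁) (B j₁) ψ) : ℂ) = r) : False := by
  classical
  have hne : (i₀, j₀) ≠ (i₁, j₁) := fun h => hi (congrArg Prod.fst h)
  let f : H → K → ℂ := fun x y => inner ℂ ((x ⊗ₜ[ℂ] y : H ⊗[ℂ] K) : HilbertTensor H K) ψ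
  -- The tensored columns preserve the inner product with `ψ`, and only the two index pairs where
  -- `ψ` goes to `r • ψ` survive.
  have hrec : ∀ x y, f x y = r * (f (A i₀ x) (B j₀ y) + f (A i₁ x) (B j₁ y)) := by
    intro x y
    simp only [f]
    rw [← sum_inner_tensorOp hA hB, mul_add,
      ← Finset.sum_pair (f := fun p : ι × κ => (r : ℂ) * inner ℂ
        ((A p.1 x ⊗ₜ[ℂ] B p.2 y : H ⊗[ℂ] K) : HilbertTensor H K) ψ) hne,
      ← Finset.univ_inter ({(i₀, j₀), (i₁, j₁)} : Finset (ι × κ)), ← Finset.sum_ite_mem]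
    refine Finset.sum_congr rfl fun p _ => ?_
    rw [tensorOp_apply_eq_of_inner_eq hA hB hi hψ hr h₀ h₁ p, tensorOp_coe_tmul]
    split_ifs
    · rw [inner_smul_right]
    · rw [inner_zero_right]
  -- Each use of `hrec` gains a factor `r`; the two branches recombine by Cauchy–Schwarz in `ℝ²`,
  -- since the columns do not increase norms.
  have hbound : ∀ (k : ℕ) x y, ‖f x y‖ ≤ r ^ k * (‖x‖ * ‖y‖) := by
    intro k
    induction k with
    | zero =>
      intro x y
      refine (norm_inner_le_norm _ _).trans ?_
      rw [UniformSpace.Completion.norm_coe, TensorProduct.norm_tmul, hψ]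
      simp
    | succ k ih =>
      intro x y
      have hx := norm_sq_add_norm_sq_le hA hi x
      have hy := norm_sq_add_norm_sq_le hB hj y
      have hcs : ‖A i₀ x‖ * ‖B j₀ y‖ + ‖A i₁ x‖ * ‖B j₁ y‖ ≤ ‖x‖ * ‖y‖ := by
        refine abs_le_of_sq_le_sq' ?_ (by positivity) |>.2
        have := mul_le_mul hx hy (by positivity) (by positivity)
        nlinarith [sq_nonneg (‖A i₀ x‖ * ‖B j₁ y‖ - ‖A i₁ x‖ * ‖B j₀ y‖)]
      rw [hrec, norm_mul, Complex.norm_real, Real.norm_of_nonneg hr₀]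
      calc r * ‖f (A i₀ x) (B j₀ y) + f (A i₁ x) (B j₁ y)‖
          ≤ r * (r ^ k * (‖A i₀ x‖ * ‖B j₀ y‖) + r ^ k * (‖A i₁ x‖ * ‖B j₁ y‖)) := by
            gcongr
            exact (norm_add_le _ _).trans (add_le_add (ih _ _) (ih _ _))
        _ = r ^ (k + 1) * (‖A i₀ x‖ * ‖B j₀ y‖ + ‖A i₁ x‖ * ‖B j₁ y‖) := by ring
        _ ≤ r ^ (k + 1) * (‖x‖ * ‖y‖) := by gcongr
  have hlim : Tendsto (fun k : ℕ => r ^ k) atTop (𝓝 0) :=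
    tendsto_pow_atTop_nhds_zero_of_lt_one hr₀ (by nlinarith)
  have hψ0 : ψ = 0 := by
    refine eq_zero_of_inner_tmul_eq_zero fun x y => ?_
    have : ‖f x y‖ ≤ 0 := by
      refine ge_of_tendsto (by simpa using hlim.mul_const (‖x‖ * ‖y‖)) ?_
      exact Eventually.of_forall fun k => hbound k x y
    exact norm_le_zero_iff.mp this
  simp [hψ0] at hψ

end NoEmbezzlement

/-! ### Columns of unitaries, restriction to generators, and boundedness -/

theorem sum_star_mul_self_col {n : ℕ} {A : Type*} [Ring A] [StarRing A]
    {U : Matrix (Fin n) (Fin n) A} (hU : U ∈ unitary (Matrix (Fin n) (Fin n) A)) (j : Fin n) :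
    ∑ i, star (U i j) * U i j = 1 := by
  have h := congrFun (congrFun (Unitary.mem_iff.mp hU).1 j) j
  rwa [Matrix.mul_apply, Matrix.one_apply_eq] at h

theorem notMem_Bqs {n m : ℕ} {c : Matrix (Fin n × Fin n) (Fin m × Fin m) ℂ} {i₀ i₁ : Fin n}
    {j₀ j₁ : Fin m} (hi : i₀ ≠ i₁) (hj : j₀ ≠ j₁) {r : ℝ} (hr₀ : 0 ≤ r) (hr : 2 * r ^ 2 = 1)
    (h₀ : c (i₀, i₀) (j₀, j₀) = r) (h₁ : c (i₁, i₀) (j₁, j₀) = r) : c ∉ Bqs.{u} n m := by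
  rintro ⟨H, _, _, _, K, _, _, _, U, V, ψ, hU, hV, hψ, hc⟩
  exact not_perfect_embezzlement (A := fun i => U i i₀) (B := fun j => V j j₀)
    (sum_star_mul_self_col hU i₀) (sum_star_mul_self_col hV j₀) hi hj hψ hr₀ hr
    ((hc _ _ _ _).symm.trans h₀) ((hc _ _ _ _).symm.trans h₁)

/-- The correlations `⟨(U_ij ⊗ V_kl)ψ, ψ⟩` inside a family indexed by all letters. -/
def genPart {n m : ℕ} (c : Matrix (Letter n) (Letter m) ℂ) :
    Matrix (Fin n × Fin n) (Fin m × Fin m) ℂ :=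
  fun p q => c (.gen p.1 p.2) (.gen q.1 q.2)

theorem continuous_genPart {n m : ℕ} : Continuous (genPart (n := n) (m := m)) :=
  continuous_pi fun p => continuous_pi fun q =>
    (continuous_apply (Letter.gen q.1 q.2)).comp (continuous_apply (Letter.gen p.1 p.2))

theorem genPart_mem_Bqs {n m : ℕ} {c : Matrix (Letter n) (Letter m) ℂ} (hc : c ∈ UCqs.{u} n m) :
    genPart c ∈ Bqs.{u} n m := by
  obtain ⟨H, _, _, _, K, _, _, _, U, V, ψ, hU, hV, hψ, hc⟩ := hc
  exact ⟨H, _, _, inferInstance, K, _, _, inferInstance, U, V, ψ, hU, hV, hψ,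
    fun i j k l => hc _ _⟩

theorem genPart_mem_Bqa {n m : ℕ} {c : Matrix (Letter n) (Letter m) ℂ} (hc : c ∈ UCqa.{v} n m) :
    genPart c ∈ Bqa.{v} n m := by
  obtain ⟨s, hs, hc⟩ := hc
  exact ⟨s, hs, fun i j k l => hc _ _⟩

theorem norm_eval_le_one {n : ℕ} {A : Type*} [CStarAlgebra A] [Nontrivial A]
    {U : Matrix (Fin n) (Fin n) A} (hU : U ∈ unitary (Matrix (Fin n) (Fin n) A))
    (x : Letter n) : ‖x.eval U‖ ≤ 1 := by
  cases x with
  | one => exact CStarRing.norm_one.le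
  | gen i j => exact norm_entry_le_one hU i j
  | adj i j => exact (norm_star _).trans_le (norm_entry_le_one hU i j)

/-- This bound places the correlations in a compact box, from which a limit point is extracted. -/
theorem norm_le_one_of_mem_UCqs {n m : ℕ} {c : Matrix (Letter n) (Letter m) ℂ}
    (hc : c ∈ UCqs.{u} n m) (x : Letter n) (y : Letter m) : ‖c x y‖ ≤ 1 := by
  obtain ⟨H, _, _, _, K, _, _, _, U, V, ψ, hU, hV, hψ, hc⟩ := hc
  have hne : ψ ≠ 0 := by
    rintro rfl
    simp at hψ
  -- The entry bound needs a nonzero operator algebra; if a factor were zero, the tensor product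
  -- would contain no unit vector.
  have hH : Nontrivial H := by
    by_contra h
    rw [not_nontrivial_iff_subsingleton] at h
    refine hne (eq_zero_of_inner_tmul_eq_zero fun x y => ?_)
    rw [Subsingleton.elim x 0, TensorProduct.zero_tmul, UniformSpace.Completion.coe_zero,
      inner_zero_left]
  have hK : Nontrivial K := by
    by_contra h
    rw [not_nontrivial_iff_subsingleton] at h
    refine hne (eq_zero_of_inner_tmul_eq_zero fun x y => ?_)
    rw [Subsingleton.elim y 0, TensorProduct.tmul_zero, UniformSpace.Completion.coe_zero,
      inner_zero_left]
  rw [hc]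
  calc _ ≤ ‖ψ‖ * ‖tensorOp (x.eval U) (y.eval V) ψ‖ := norm_inner_le_norm _ _
    _ ≤ ‖ψ‖ * (‖x.eval U‖ * ‖y.eval V‖ * ‖ψ‖) := by
        gcongr
        exact (ContinuousLinearMap.le_opNorm _ _).trans (by gcongr; exact norm_tensorOp_le _ _)
    _ ≤ 1 * (1 * 1 * 1) := by
        rw [hψ]; gcongr
        · exact norm_eval_le_one hU x
        · exact norm_eval_le_one hV y
    _ = 1 := by norm_num

/-! ## Approximate embezzlement in finite dimensions -/

section PermMatrix

/-- The `n × n` matrix over `M_p` of a permutation of `Fin n × Fin p`. -/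
def permBlock {n p : ℕ} (σ : Equiv.Perm (Fin n × Fin p)) :
    Matrix (Fin n) (Fin n) (Matrix (Fin p) (Fin p) ℂ) :=
  fun i j k l => if σ (j, l) = (i, k) then 1 else 0

theorem star_permBlock {n p : ℕ} (σ : Equiv.Perm (Fin n × Fin p)) :
    star (permBlock σ) = permBlock σ⁻¹ := by
  ext i j k l
  have : (star (permBlock σ)) i j k l = star (permBlock σ j i l k) := rfl
  rw [this, permBlock, permBlock]
  simp only [Equiv.Perm.inv_eq_iff_eq, eq_comm (a := (j, l))]
  split_ifs <;> simp

theorem permBlock_mul_inv {n p : ℕ} (σ : Equiv.Perm (Fin n × Fin p)) :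
    permBlock σ * permBlock σ⁻¹ = 1 := by
  ext i j k l
  have h : (permBlock σ * permBlock σ⁻¹) i j k l
      = ∑ q : Fin n × Fin p, permBlock σ i q.1 k q.2 * permBlock σ⁻¹ q.1 j q.2 l := by
    rw [Matrix.mul_apply, Matrix.sum_apply, Fintype.sum_prod_type]
    rfl
  have h' : (1 : Matrix (Fin n) (Fin n) (Matrix (Fin p) (Fin p) ℂ)) i j k l
      = if (j, l) = (i, k) then 1 else 0 := by
    by_cases hij : i = j
    · subst hij
      simp [Matrix.one_apply, eq_comm]
    · simp [hij, Ne.symm hij]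
  rw [h, h', Finset.sum_eq_single (σ⁻¹ (j, l))]
  · simp [permBlock]
  · intro q _ hq
    have : σ⁻¹ (j, l) ≠ (q.1, q.2) := fun h => hq h.symm
    rw [permBlock, permBlock, if_neg this, mul_zero]
  · simp

theorem permBlock_mem_unitary {n p : ℕ} (σ : Equiv.Perm (Fin n × Fin p)) :
    permBlock σ ∈ unitary (Matrix (Fin n) (Fin n) (Matrix (Fin p) (Fin p) ℂ)) := by
  rw [Unitary.mem_iff, star_permBlock]
  exact ⟨by simpa using permBlock_mul_inv σ⁻¹, permBlock_mul_inv σ⟩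

end PermMatrix

/-- `⟨(X ⊗ Y)ψ, ψ⟩` for the vector `ψ = ∑ k, a k • e k ⊗ e k`. -/
noncomputable def diagCorr {p : ℕ} (a : Fin p → ℝ) (X Y : Matrix (Fin p) (Fin p) ℂ) : ℂ :=
  ∑ k, ∑ l, (a k * a l : ℝ) * (X k l * Y k l)

/-- Splitting `l` into its last binary digit and the remaining digits is injective, so this partial
map on a finite set extends to a permutation. How it extends is irrelevant: only the column of index
0 is used. -/
theorem exists_halving_perm {n p : ℕ} (hn : 2 ≤ n) :
    ∃ σ : Equiv.Perm (Fin n × Fin p), ∀ l : Fin p,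
      σ (⟨0, by omega⟩, l) = (⟨l % 2, by omega⟩, ⟨l / 2, by omega⟩) := by
  let f : Fin n × Fin p → Fin n × Fin p := fun q => (⟨q.2 % 2, by omega⟩, ⟨q.2 / 2, by omega⟩)
  have hf : Set.InjOn f {q | q.1 = ⟨0, by omega⟩} := by
    rintro ⟨i, k⟩ hi ⟨j, l⟩ hj h
    simp only [f, Prod.mk.injEq, Fin.mk.injEq] at h
    refine Prod.ext (hi.trans hj.symm) (Fin.ext ?_)
    simp only
    omega
  obtain ⟨g, hg⟩ := Set.MapsTo.exists_equiv_extend_of_card_eq (t := Finset.univ)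
    (Finset.card_univ).symm (fun _ _ => by simp) hf
  refine ⟨g.trans (Equiv.subtypeUnivEquiv (by simp)), fun l => ?_⟩
  exact hg (⟨0, by omega⟩, l) rfl

/-- The Schmidt coefficients `2 ^ (-⌊log₂ k⌋ / 2)`, not normalized. -/
noncomputable def schmidtCoeff (r : ℝ) (k : ℕ) : ℝ := if k = 0 then 0 else r ^ Nat.log 2 k

/-- Self-similarity along the binary tree: each child `2j`, `2j + 1` carries `r` times the
coefficient of `j`. The node 0 is excluded, being its own child. -/
theorem schmidtCoeff_two_mul_add (r : ℝ) {j : ℕ} (hj : j ≠ 0) {i : ℕ} (hi : i < 2) :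
    schmidtCoeff r (2 * j + i) = r * schmidtCoeff r j := by
  have h : Nat.log 2 (2 * j + i) = Nat.log 2 j + 1 := by
    rw [Nat.log_of_one_lt_of_le one_lt_two (by omega)]
    congr 2
    omega
  rw [schmidtCoeff, schmidtCoeff, if_neg hj, if_neg (by omega), h, pow_succ']

theorem sum_range_two_mul (f : ℕ → ℝ) (M : ℕ) :
    ∑ l ∈ Finset.range (2 * M), f l = ∑ j ∈ Finset.range M, (f (2 * j) + f (2 * j + 1)) := by
  induction M with
  | zero => simp
  | succ M ih =>
    rw [mul_add, mul_one, Finset.sum_range_succ, Finset.sum_range_succ, ih,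
      Finset.sum_range_succ]
    ring

/-- Each dyadic block `[2^k, 2^(k+1))` contributes `2^k * r^(2k) = 1`. In the induction the children
of `j ≠ 0` reproduce its weight, while the pair 0, 1 adds the new 1. -/
theorem sum_schmidtCoeff_sq {r : ℝ} (hr : 2 * r ^ 2 = 1) (N : ℕ) :
    ∑ l ∈ Finset.range (2 ^ N), schmidtCoeff r l ^ 2 = N := by
  induction N with
  | zero => simp [schmidtCoeff]
  | succ N ih =>
    have hz : (0 : ℕ) ∈ Finset.range (2 ^ N) := by simp
    have h : ∀ j, schmidtCoeff r (2 * j) ^ 2 + schmidtCoeff r (2 * j + 1) ^ 2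
        = schmidtCoeff r j ^ 2 + if j = 0 then 1 else 0 := by
      intro j
      split_ifs with hj
      · subst hj
        simp [schmidtCoeff]
      · have h0 := schmidtCoeff_two_mul_add r hj two_pos
        rw [add_zero] at h0
        rw [h0, schmidtCoeff_two_mul_add r hj one_lt_two]
        linear_combination schmidtCoeff r j ^ 2 * hr
    rw [pow_succ', sum_range_two_mul]
    simp only [h]
    rw [Finset.sum_add_distrib, ih, Finset.sum_ite_eq' (Finset.range (2 ^ N)) 0, if_pos hz]
    push_cast; ring

/-- By self-similarity the term `l = 2j + i` equals `r` times the squared coefficient of `j`, and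
`j` runs over one binary level fewer than `l`; hence `N` rather than `N + 1`. -/
theorem sum_schmidtCoeff_mul_half {r : ℝ} (hr : 2 * r ^ 2 = 1) (N : ℕ) {i : ℕ} (hi : i < 2) :
    ∑ l ∈ Finset.range (2 ^ (N + 1)),
      (if l % 2 = i then schmidtCoeff r (l / 2) * schmidtCoeff r l else 0) = r * N := by
  rw [pow_succ', sum_range_two_mul, ← sum_schmidtCoeff_sq hr N, Finset.mul_sum]
  refine Finset.sum_congr rfl fun j _ => ?_
  have h1 : (2 * j + 1) / 2 = j := by omega
  have h2 : (2 * j) / 2 = j := by omega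
  have h3 : (2 * j) % 2 = 0 := by omega
  have h4 : (2 * j + 1) % 2 = 1 := by omega
  rw [h1, h2, h3, h4]
  by_cases hj : j = 0
  · subst hj; simp [schmidtCoeff]
  · have h0 := schmidtCoeff_two_mul_add r hj two_pos
    rw [add_zero] at h0
    rw [h0, schmidtCoeff_two_mul_add r hj one_lt_two]
    interval_cases i <;> simp <;> ring

theorem exists_approx_embezzlement {n m : ℕ} (hn : 2 ≤ n) (hm : 2 ≤ m) {r : ℝ}
    (hr : 2 * r ^ 2 = 1) (N : ℕ) :
    ∃ (p : ℕ) (U : Matrix (Fin n) (Fin n) (Matrix (Fin p) (Fin p) ℂ))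
      (V : Matrix (Fin m) (Fin m) (Matrix (Fin p) (Fin p) ℂ)) (a : Fin p → ℝ),
      U ∈ unitary (Matrix (Fin n) (Fin n) (Matrix (Fin p) (Fin p) ℂ)) ∧
      V ∈ unitary (Matrix (Fin m) (Fin m) (Matrix (Fin p) (Fin p) ℂ)) ∧
      ∑ k, a k ^ 2 = 1 ∧
      ∀ i (hi : i < 2), diagCorr a (U ⟨i, by omega⟩ ⟨0, by omega⟩) (V ⟨i, by omega⟩ ⟨0, by omega⟩)
        = (r * (N / (N + 1)) : ℝ) := by
  obtain ⟨σ, hσ⟩ := exists_halving_perm (p := 2 ^ (N + 1)) hn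
  obtain ⟨τ, hτ⟩ := exists_halving_perm (p := 2 ^ (N + 1)) hm
  have hN : (0 : ℝ) < N + 1 := by positivity
  -- Normalization: the unnormalized vector on `2 ^ (N + 1)` indices has squared norm `N + 1`.
  let b : ℝ := (√(N + 1))⁻¹
  have hb : b * b = (N + 1 : ℝ)⁻¹ := by
    rw [← mul_inv, Real.mul_self_sqrt hN.le]
  refine ⟨2 ^ (N + 1), permBlock σ, permBlock τ, fun k => b * schmidtCoeff r k,
    permBlock_mem_unitary σ, permBlock_mem_unitary τ, ?_, fun i hi => ?_⟩
  · simp only [mul_pow]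
    rw [← Finset.mul_sum, Fin.sum_univ_eq_sum_range (fun k => schmidtCoeff r k ^ 2),
      sum_schmidtCoeff_sq hr, sq, hb]
    push_cast
    exact inv_mul_cancel₀ hN.ne'
  · have hterm : ∀ l : Fin (2 ^ (N + 1)), ∑ k : Fin (2 ^ (N + 1)),
        ((b * schmidtCoeff r k * (b * schmidtCoeff r l) : ℝ) : ℂ)
          * (permBlock σ ⟨i, by omega⟩ ⟨0, by omega⟩ k l
            * permBlock τ ⟨i, by omega⟩ ⟨0, by omega⟩ k l)
        = (((N + 1 : ℝ)⁻¹ * if (l : ℕ) % 2 = i then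
            schmidtCoeff r ((l : ℕ) / 2) * schmidtCoeff r l else 0 : ℝ) : ℂ) := by
      intro l
      -- Both blocks send the basis vector `l` to `l / 2` if `l % 2 = i` and to zero otherwise.
      rw [Finset.sum_eq_single ⟨l / 2, by omega⟩]
      · simp only [permBlock, hσ, hτ, Prod.mk.injEq, Fin.mk.injEq, and_true]
        rw [← hb]
        split_ifs <;> push_cast <;> ring
      · intro k _ hk
        simp [permBlock, hσ, hk.symm]
      · simp
    rw [diagCorr, Finset.sum_comm]
    simp only [hterm]
    rw [← Complex.ofReal_sum, ← Finset.mul_sum,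
      Fin.sum_univ_eq_sum_range (fun l => if l % 2 = i then
        schmidtCoeff r (l / 2) * schmidtCoeff r l else 0), sum_schmidtCoeff_mul_half hr N hi]
    congr 1
    field_simp

/-! ## Correlations of finite-dimensional unitaries -/

section StarHom

variable {n : ℕ} {A B : Type*} [Ring A] [StarRing A] [Algebra ℂ A] [Ring B] [StarRing B]
  [Algebra ℂ B]

theorem map_mem_unitary (f : A →⋆ₐ[ℂ] B) {U : Matrix (Fin n) (Fin n) A}
    (hU : U ∈ unitary (Matrix (Fin n) (Fin n) A)) :
    U.map f ∈ unitary (Matrix (Fin n) (Fin n) B) := by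
  have hs : star (U.map f) = (star U).map f := by
    ext i j
    exact (map_star f (U j i)).symm
  rw [Unitary.mem_iff] at hU ⊢
  rw [hs, ← Matrix.map_mul, ← Matrix.map_mul, hU.1, hU.2]
  exact ⟨Matrix.map_one f (map_zero f) (map_one f), Matrix.map_one f (map_zero f) (map_one f)⟩

theorem eval_map (f : A →⋆ₐ[ℂ] B) (U : Matrix (Fin n) (Fin n) A) (x : Letter n) :
    x.eval (U.map f) = f (x.eval U) := by
  cases x with
  | one => exact (map_one f).symm
  | gen i j => rfl
  | adj i j => exact (map_star f (U i j)).symm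

theorem matrixPos_map (f : A →⋆ₐ[ℂ] B) {k : ℕ} {X : Matrix (Fin k) (Fin k) A}
    (hX : MatrixPos X) : MatrixPos (X.map f) := by
  obtain ⟨Y, rfl⟩ := hX
  refine ⟨Y.map f, ?_⟩
  have hs : star (Y.map f) = (star Y).map f := by
    ext i j
    exact (map_star f (Y j i)).symm
  rw [hs, Matrix.map_mul]

end StarHom

/-- The Hilbert space `ℂ^p` in any universe. -/
abbrev StdSpace (p : ℕ) : Type u := EuclideanSpace ℂ (ULift.{u} (Fin p))

/-- The matrix algebra `M_p` as the algebra of operators on a Hilbert space in any universe. -/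
noncomputable def matrixEquivCLM (p : ℕ) : Matrix (Fin p) (Fin p) ℂ ≃⋆ₐ[ℂ]
    (StdSpace.{u} p →L[ℂ] StdSpace.{u} p) :=
  (StarAlgEquiv.ofAlgEquiv (Matrix.reindexAlgEquiv ℂ ℂ Equiv.ulift.symm)
    (fun _ => rfl)).trans Matrix.toEuclideanCLM

theorem inner_single_matrixEquivCLM {p : ℕ} (X : Matrix (Fin p) (Fin p) ℂ) (k l : Fin p) :
    (inner ℂ (EuclideanSpace.single (ULift.up k) 1 : StdSpace.{u} p)
      (matrixEquivCLM.{u} p X (EuclideanSpace.single (ULift.up l) 1)) : ℂ) = X k l := by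
  have h : matrixEquivCLM.{u} p X = Matrix.toEuclideanCLM (n := ULift.{u} (Fin p)) (𝕜 := ℂ)
    (Matrix.reindex Equiv.ulift.symm Equiv.ulift.symm X) := rfl
  rw [h, EuclideanSpace.inner_single_left, Matrix.ofLp_toEuclideanCLM]
  simp

theorem diagCorr_mem_UCqs {n m p : ℕ} {U : Matrix (Fin n) (Fin n) (Matrix (Fin p) (Fin p) ℂ)}
    {V : Matrix (Fin m) (Fin m) (Matrix (Fin p) (Fin p) ℂ)}
    (hU : U ∈ unitary (Matrix (Fin n) (Fin n) (Matrix (Fin p) (Fin p) ℂ)))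
    (hV : V ∈ unitary (Matrix (Fin m) (Fin m) (Matrix (Fin p) (Fin p) ℂ)))
    {a : Fin p → ℝ} (ha : ∑ k, a k ^ 2 = 1) :
    (fun x y => diagCorr a (x.eval U) (y.eval V)) ∈ UCqs.{u} n m := by
  let f : Matrix (Fin p) (Fin p) ℂ →⋆ₐ[ℂ] (StdSpace.{u} p →L[ℂ] StdSpace.{u} p) :=
    (matrixEquivCLM.{u} p : Matrix (Fin p) (Fin p) ℂ →⋆ₐ[ℂ] (StdSpace.{u} p →L[ℂ] StdSpace.{u} p))
  let e : Fin p → StdSpace.{u} p := fun k => EuclideanSpace.single (ULift.up k) 1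
  have he : Orthonormal ℂ e := by
    rw [orthonormal_iff_ite]
    intro i j
    simp [e, EuclideanSpace.inner_single_left]
  let ψ : StdSpace.{u} p ⊗[ℂ] StdSpace.{u} p := ∑ k, ((a k : ℂ) • e k) ⊗ₜ[ℂ] e k
  have hψ : ‖ψ‖ = 1 := by
    have h : ‖ψ‖ ^ 2 = 1 := by
      rw [norm_sq_sum_tmul _ he, ← ha]
      refine Finset.sum_congr rfl fun k _ => ?_
      rw [norm_smul, he.1 k, mul_one, Complex.norm_real, Real.norm_eq_abs, sq_abs]
    exact (pow_eq_one_iff_of_nonneg (norm_nonneg ψ) two_ne_zero).mp h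
  refine ⟨StdSpace.{u} p, inferInstance, inferInstance, inferInstance, StdSpace.{u} p, inferInstance, inferInstance,
    inferInstance, U.map f, V.map f, (ψ : HilbertTensor (StdSpace.{u} p) (StdSpace.{u} p)), map_mem_unitary f hU,
    map_mem_unitary f hV, ?_, fun x y => ?_⟩
  · rw [UniformSpace.Completion.norm_coe, hψ]
  · rw [eval_map, eval_map, tensorOp, ContinuousLinearMap.completion_apply_coe,
      UniformSpace.Completion.inner_coe, LinearMap.mkContinuous_apply]
    simp only [ψ, map_sum, TensorProduct.map_tmul, ContinuousLinearMap.coe_coe, map_smul,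
      sum_inner, inner_sum, TensorProduct.inner_tmul, inner_smul_left, inner_smul_right]
    rw [Finset.sum_comm, diagCorr]
    refine Finset.sum_congr rfl fun k _ => Finset.sum_congr rfl fun l _ => ?_
    have h : ∀ X : Matrix (Fin p) (Fin p) ℂ, (inner ℂ (e k) (f X (e l)) : ℂ) = X k l :=
      fun X => inner_single_matrixEquivCLM X k l
    rw [h, h, Complex.conj_ofReal]
    push_cast
    ring

/-- The universal property concerns C*-algebras in a fixed universe, so it is applied to the
operators on `StdSpace p` and the result is carried back to `M_p`; `p` is nonzero so that this
algebra is nontrivial. -/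
theorem exists_unc_matrix_hom {n p : ℕ} [Nonempty (Fin p)]
    {U : Matrix (Fin n) (Fin n) (Matrix (Fin p) (Fin p) ℂ)}
    (hU : U ∈ unitary (Matrix (Fin n) (Fin n) (Matrix (Fin p) (Fin p) ℂ))) :
    ∃ π : Unc.{v} n →⋆ₐ[ℂ] Matrix (Fin p) (Fin p) ℂ,
      ∀ x : Letter n, π (x.eval (uncGen.{v} n)) = x.eval U := by
  let f : Matrix (Fin p) (Fin p) ℂ →⋆ₐ[ℂ] (StdSpace.{v} p →L[ℂ] StdSpace.{v} p) :=
    (matrixEquivCLM.{v} p : Matrix (Fin p) (Fin p) ℂ →⋆ₐ[ℂ] (StdSpace.{v} p →L[ℂ] StdSpace.{v} p))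
  let g : (StdSpace.{v} p →L[ℂ] StdSpace.{v} p) →⋆ₐ[ℂ] Matrix (Fin p) (Fin p) ℂ :=
    ((matrixEquivCLM.{v} p).symm : (StdSpace.{v} p →L[ℂ] StdSpace.{v} p) →⋆ₐ[ℂ] Matrix (Fin p) (Fin p) ℂ)
  obtain ⟨ρ, hρ, -⟩ := unc_universal.{v} (U.map f) (map_mem_unitary f hU)
  refine ⟨g.comp ρ, fun x => ?_⟩
  have h : (uncGen.{v} n).map (g.comp ρ) = U := by
    ext1 i j
    exact (congrArg g (hρ i j)).trans ((matrixEquivCLM.{v} p).symm_apply_apply (U i j))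
  rw [← eval_map, h]

/-- The restriction of a representation to an operator system. -/
noncomputable def OperatorSystem.restrict {A : Type*} [CStarAlgebra A] (S : OperatorSystem A)
    {p : ℕ} (π : A →⋆ₐ[ℂ] Matrix (Fin p) (Fin p) ℂ) :
    S.toSubmodule →ₗ[ℂ] Matrix (Fin p) (Fin p) ℂ :=
  π.toAlgHom.toLinearMap ∘ₗ S.toSubmodule.subtype

theorem isUCP_restrict {A : Type*} [CStarAlgebra A] (S : OperatorSystem A)
    {p : ℕ} (π : A →⋆ₐ[ℂ] Matrix (Fin p) (Fin p) ℂ) : IsUCP S (S.restrict π) :=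
  ⟨map_one π, fun _ _ hX => matrixPos_map π hX⟩

/-- The functional `x ↦ ⟨(φ ⊗ ψ)(x) v, v⟩` for `v = ∑ k, a k • e k ⊗ e k`. -/
noncomputable def diagFunctional {M N : Type*} [AddCommGroup M] [Module ℂ M] [AddCommGroup N]
    [Module ℂ N] {p : ℕ} (a : Fin p → ℝ) (φ : M →ₗ[ℂ] Matrix (Fin p) (Fin p) ℂ)
    (ψ : N →ₗ[ℂ] Matrix (Fin p) (Fin p) ℂ) : M ⊗[ℂ] N →ₗ[ℂ] ℂ where
  toFun z := ∑ k, ∑ l, (a k * a l : ℝ) * tensorMap φ ψ z (k, k) (l, l)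
  map_add' z w := by simp [mul_add, Finset.sum_add_distrib]
  map_smul' c z := by
    simp only [map_smul, Matrix.smul_apply, smul_eq_mul, Finset.mul_sum, RingHom.id_apply]
    exact Finset.sum_congr rfl fun k _ => Finset.sum_congr rfl fun l _ => by ring

theorem diagFunctional_tmul {M N : Type*} [AddCommGroup M] [Module ℂ M] [AddCommGroup N]
    [Module ℂ N] {p : ℕ} (a : Fin p → ℝ) (φ : M →ₗ[ℂ] Matrix (Fin p) (Fin p) ℂ)
    (ψ : N →ₗ[ℂ] Matrix (Fin p) (Fin p) ℂ) (x : M) (y : N) :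
    diagFunctional a φ ψ (x ⊗ₜ[ℂ] y) = diagCorr a (φ x) (ψ y) := rfl

theorem diagCorr_one {p : ℕ} {a : Fin p → ℝ} (ha : ∑ k, a k ^ 2 = 1) :
    diagCorr a 1 1 = 1 := by
  have h : ((∑ k, a k ^ 2 : ℝ) : ℂ) = 1 := by rw [ha, Complex.ofReal_one]
  rw [← h, diagCorr]
  push_cast
  refine Finset.sum_congr rfl fun k _ => ?_
  rw [Finset.sum_eq_single k]
  · simp [sq]
  · intro l _ hl
    simp [Matrix.one_apply_ne hl.symm]
  · simp

theorem isMinState_diagFunctional {A B : Type*} [CStarAlgebra A] [CStarAlgebra B]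
    (S : OperatorSystem A) (T : OperatorSystem B) {p : ℕ} {a : Fin p → ℝ}
    (ha : ∑ k, a k ^ 2 = 1) {φ : S.toSubmodule →ₗ[ℂ] Matrix (Fin p) (Fin p) ℂ}
    {ψ : T.toSubmodule →ₗ[ℂ] Matrix (Fin p) (Fin p) ℂ} (hφ : IsUCP S φ) (hψ : IsUCP T ψ) :
    IsMinState S T (diagFunctional a φ ψ) := by
  refine ⟨?_, fun x hx => ?_⟩
  · rw [diagFunctional_tmul, hφ.1, hψ.1, diagCorr_one ha]
  -- The vector is supported on the pairs `(k, k)`, so positivity of the corresponding principal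
  -- submatrix suffices.
  · have h := ((hx p p φ ψ hφ hψ).submatrix fun k : Fin p => (k, k)).dotProduct_mulVec_nonneg
      fun k => (a k : ℂ)
    convert h using 1
    simp only [diagFunctional, LinearMap.coe_mk, AddHom.coe_mk, dotProduct, Matrix.mulVec,
      Finset.mul_sum]
    refine Finset.sum_congr rfl fun k _ => Finset.sum_congr rfl fun l _ => ?_
    simp only [Pi.star_apply, Matrix.submatrix_apply, RCLike.star_def, Complex.conj_ofReal]
    push_cast
    ring

theorem diagCorr_mem_UCqa {n m p : ℕ} {U : Matrix (Fin n) (Fin n) (Matrix (Fin p) (Fin p) ℂ)}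
    {V : Matrix (Fin m) (Fin m) (Matrix (Fin p) (Fin p) ℂ)}
    (hU : U ∈ unitary (Matrix (Fin n) (Fin n) (Matrix (Fin p) (Fin p) ℂ)))
    (hV : V ∈ unitary (Matrix (Fin m) (Fin m) (Matrix (Fin p) (Fin p) ℂ)))
    {a : Fin p → ℝ} (ha : ∑ k, a k ^ 2 = 1) :
    (fun x y => diagCorr a (x.eval U) (y.eval V)) ∈ UCqa.{v} n m := by
  have hp : Nonempty (Fin p) := by
    by_contra h
    rw [not_nonempty_iff] at h
    simp at ha
  obtain ⟨π, hπ⟩ := exists_unc_matrix_hom.{v} hU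
  obtain ⟨ρ, hρ⟩ := exists_unc_matrix_hom.{v} hV
  refine ⟨diagFunctional a ((Vsys.{v} n).restrict π) ((Vsys.{v} m).restrict ρ),
    isMinState_diagFunctional _ _ ha (isUCP_restrict _ π) (isUCP_restrict _ ρ), fun x y => ?_⟩
  change diagCorr a (x.eval U) (y.eval V) = _
  rw [← hπ, ← hρ]
  rfl

/-! ## Limits of correlations -/

theorem span_letter_tmul_letter (n m : ℕ) :
    Submodule.span ℂ (Set.range fun q : Letter n × Letter m =>
      (Vsys.letter.{v} q.1 ⊗ₜ[ℂ] Vsys.letter.{v} q.2 :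
        (Vsys.{v} n).toSubmodule ⊗[ℂ] (Vsys.{v} m).toSubmodule)) = ⊤ := by
  have hspan : ∀ k, Submodule.span ℂ (Set.range (Vsys.letter.{v} (n := k))) = ⊤ := by
    intro k
    have h := Submodule.span_span_coe_preimage (R := ℂ)
      (s := Set.range (Letter.eval (uncGen.{v} k)))
    refine Eq.trans (congrArg _ (Set.ext fun x => ?_)) h
    constructor
    · rintro ⟨a, rfl⟩
      exact ⟨a, rfl⟩
    · rintro ⟨a, ha⟩
      exact ⟨a, Subtype.ext ha⟩
  have h := TensorProduct.map₂_mk_top_top_eq_top ℂ (Vsys.{v} n).toSubmodule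
    (Vsys.{v} m).toSubmodule
  rw [← hspan n, ← hspan m, Submodule.map₂_span_span, Set.image2_range] at h
  exact h

/-- Convergence on the letters propagates to the whole tensor product, which they span. The
pointwise limit is linear, and unitality and positivity survive the limit. -/
theorem mem_UCqa_of_tendsto {n m : ℕ} {α : Type*} {F : Filter α} [F.NeBot]
    {c : α → Matrix (Letter n) (Letter m) ℂ} (hc : ∀ N, c N ∈ UCqa.{v} n m)
    {c₀ : Matrix (Letter n) (Letter m) ℂ} (h : Tendsto c F (𝓝 c₀)) : c₀ ∈ UCqa.{v} n m := by
  choose s hs hcs using hc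
  have hlim : ∀ z, ∃ L : ℂ, Tendsto (fun N => s N z) F (𝓝 L) := by
    intro z
    have hz : z ∈ Submodule.span ℂ (Set.range fun q : Letter n × Letter m =>
      (Vsys.letter.{v} q.1 ⊗ₜ[ℂ] Vsys.letter.{v} q.2 :
        (Vsys.{v} n).toSubmodule ⊗[ℂ] (Vsys.{v} m).toSubmodule)) := by
      rw [span_letter_tmul_letter]
      exact Submodule.mem_top
    induction hz using Submodule.span_induction with
    | mem z hz =>
      obtain ⟨q, rfl⟩ := hz
      exact ⟨c₀ q.1 q.2, by
        simp only [← hcs]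
        exact tendsto_pi_nhds.mp (tendsto_pi_nhds.mp h q.1) q.2⟩
    | zero => exact ⟨0, by simp⟩
    | add z w _ _ hz hw =>
      obtain ⟨L, hL⟩ := hz
      obtain ⟨L', hL'⟩ := hw
      exact ⟨L + L', by simpa using hL.add hL'⟩
    | smul r z _ hz =>
      obtain ⟨L, hL⟩ := hz
      exact ⟨r • L, by simpa using hL.const_smul r⟩
  choose f hf using hlim
  refine ⟨linearMapOfTendsto f s (tendsto_pi_nhds.mpr hf), ⟨?_, fun z hz => ?_⟩, fun x y => ?_⟩
  · refine tendsto_nhds_unique (hf _) ?_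
    simp only [(hs _).1]
    exact tendsto_const_nhds
  · exact ge_of_tendsto' (hf z) fun N => (hs N).2 z hz
  · refine tendsto_nhds_unique (tendsto_pi_nhds.mp (tendsto_pi_nhds.mp h x) y) ?_
    simp only [hcs]
    exact hf _

/-- A limit of spatial correlations that achieves perfect embezzlement. -/
theorem exists_limit_embezzlement {n m : ℕ} (hn : 2 ≤ n) (hm : 2 ≤ m) {r : ℝ}
    (hr : 2 * r ^ 2 = 1) :
    ∃ c : Matrix (Letter n) (Letter m) ℂ, c ∈ closure (UCqs.{u} n m) ∧ c ∈ UCqa.{v} n m ∧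
      ∀ i (hi : i < 2), c (.gen ⟨i, by omega⟩ ⟨0, by omega⟩) (.gen ⟨i, by omega⟩ ⟨0, by omega⟩)
        = r := by
  choose p U V a hU hV ha hval using fun N => exists_approx_embezzlement hn hm hr N
  let c : ℕ → Matrix (Letter n) (Letter m) ℂ :=
    fun N x y => diagCorr (a N) (x.eval (U N)) (y.eval (V N))
  have hqs : ∀ N, c N ∈ UCqs.{u} n m := fun N => diagCorr_mem_UCqs (hU N) (hV N) (ha N)
  let box : Set (Matrix (Letter n) (Letter m) ℂ) :=
    Set.univ.pi fun _ => Set.univ.pi fun _ => Metric.closedBall 0 1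
  have hbox : IsCompact box :=
    isCompact_univ_pi fun _ => isCompact_univ_pi fun _ => isCompact_closedBall 0 1
  have hmem : ∀ N, c N ∈ box := fun N x _ y _ => by
    simpa using norm_le_one_of_mem_UCqs (hqs N) x y
  -- A single ultrafilter limit serves for both memberships. It refines `atTop`, so the embezzlement
  -- entries keep their ordinary limit `r`.
  let F : Ultrafilter ℕ := hyperfilter ℕ
  obtain ⟨c₀, -, hc₀⟩ := hbox.ultrafilter_le_nhds (F.map c)
    (le_principal_iff.mpr (Eventually.of_forall (f := (F : Filter ℕ)) hmem))
  have hlim : Tendsto c F (𝓝 c₀) := hc₀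
  refine ⟨c₀, mem_closure_of_tendsto hlim (Eventually.of_forall hqs),
    mem_UCqa_of_tendsto (fun N => diagCorr_mem_UCqa (hU N) (hV N) (ha N)) hlim,
    fun i hi => ?_⟩
  refine tendsto_nhds_unique (tendsto_pi_nhds.mp (tendsto_pi_nhds.mp hlim _) _) ?_
  have h : Tendsto (fun N : ℕ => ((r * (N / (N + 1)) : ℝ) : ℂ)) atTop (𝓝 (r : ℂ)) := by
    have := (tendsto_natCast_div_add_atTop (1 : ℝ)).const_mul r
    rw [mul_one] at this
    exact (Complex.continuous_ofReal.tendsto r).comp this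
  refine (h.mono_left Nat.hyperfilter_le_atTop).congr fun N => ?_
  exact (hval N i hi).symm

end UnitaryCorrelation

theorem mainTheorem2 (n m : ℕ) (hn : 2 ≤ n) (hm : 2 ≤ m) :
    UnitaryCorrelation.Bqs.{u} n m ≠ UnitaryCorrelation.Bqa.{v} n m ∧
    UnitaryCorrelation.UCqs.{u} n m ≠ UnitaryCorrelation.UCqa.{v} n m ∧
    ¬ IsClosed (UnitaryCorrelation.UCqs.{u} n m) ∧
    ¬ IsClosed (UnitaryCorrelation.Bqs.{u} n m) := by
  have hr : 2 * (√(1 / 2)) ^ 2 = 1 := by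
    rw [Real.sq_sqrt (by norm_num)]
    norm_num
  obtain ⟨c, hcl, hqa, hc⟩ := UnitaryCorrelation.exists_limit_embezzlement.{u, v} hn hm hr
  have hB : UnitaryCorrelation.genPart c ∉ UnitaryCorrelation.Bqs.{u} n m :=
    UnitaryCorrelation.notMem_Bqs (i₀ := ⟨0, by omega⟩) (i₁ := ⟨1, by omega⟩)
      (j₀ := ⟨0, by omega⟩) (j₁ := ⟨1, by omega⟩) (by simp) (by simp) (Real.sqrt_nonneg _) hr
      (hc 0 two_pos) (hc 1 one_lt_two)
  have hUC : c ∉ UnitaryCorrelation.UCqs.{u} n m :=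
    fun h => hB (UnitaryCorrelation.genPart_mem_Bqs h)
  refine ⟨fun h => hB (h ▸ UnitaryCorrelation.genPart_mem_Bqa hqa), fun h => hUC (h ▸ hqa),
    fun h => hUC (h.closure_eq ▸ hcl), fun h => hB ?_⟩
  -- By continuity of `genPart` the restricted limit point lies in the closure of `B_qs`, which
  -- closedness would identify with `B_qs`.
  refine h.closure_eq ▸ map_mem_closure UnitaryCorrelation.continuous_genPart hcl ?_
  exact fun _ => UnitaryCorrelation.genPart_mem_Bqs
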